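/- Let $Q$ be a quiver, with possibly infinite sets $Q_0$ of vertices and $Q_1$ of arrows, and let $k$ be a field. The path coalgebra $kQ$ is the $k$-vector space with basis the paths of $Q$ (vertices being the paths of length $0$), with comultiplication $$\Delta(a_n\cdots a_1)=\sum_{i=0}^{n} a_n\cdots a_{i+1}\otimes a_i\cdots a_1,$$ where the empty products for $i=n$ and $i=0$ are the target and the source of the path respectively (so $\Delta(u)=u\otimes u$ for a vertex $u$), and with counit equal to $1$ on vertices and $0$ on paths of positive length. It is graded by path length. We say that $kQ$ admits a graded Hopf algebra structure if there are a multiplication, a unit and an antipode on $kQ$ which together with $\Delta$ and $\varepsilon$ make it a Hopf algebra whose structure maps are all homogeneous of degree $0$ for the grading by path length. Let $G$ be a group with set of conjugacy classes $\mathcal C$. A ramification data of $G$ is a formal sum $r=\sum_{C\in\mathcal C} r_C\,C$ with coefficients $r_C$ in the non-negative integers (possibly infinitely many of them non-zero); more generally, a cardinal-valued ramification data is such a formal sum in which the $r_C$ are arbitrary cardinal numbers. The Hopf quiver of $G$ with respect to $r$ has vertex set $G$, and has $r_C$ arrows from $x$ to $cx$ for each $x\in G$, $C\in\mathcal C$ and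 $c\in C$ (and no other arrows). Theorem. (1) The path coalgebra $kQ$ admits a graded Hopf algebra structure if and only if $Q$ is isomorphic to the Hopf quiver of some group with respect to a cardinal-valued ramification data. (2) The path coalgebra $kQ$ admits a graded Hopf algebra structure and there are only finitely many arrows from $x$ to $y$ for all vertices $x,y$ of $Q$ if and only if $Q$ is isomorphic to the Hopf quiver of some group with respect to a ramification data (with non-negative integer coefficients). -/

import Mathlib

open scoped TensorProduct

universe u v w

/-! ### The path coalgebra of a quiver -/

/-- The type of all paths of a quiver: a path together with its source and its target.
Vertices are the paths `Quiver.Path.nil` of length zero. -/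
abbrev QuiverPath (V : Type u) [Quiver.{v} V] : Type (max u v) :=
  Σ a b : V, Quiver.Path a b

/-- The splits of a path `α` from `a` to `b`: all pairs `(α₂, α₁)` such that `α` is `α₁` followed by
`α₂`, that is `α = α₂ α₁` when paths are written from right to left. They are listed by
increasing length of `α₂`. -/
def pathSplits {V : Type u} [Quiver.{v} V] {a : V} :
    ∀ {b : V}, Quiver.Path a b → List (Σ c : V, Quiver.Path c b × Quiver.Path a c)
  | _, .nil => [⟨a, .nil, .nil⟩]
  | _, .cons p e =>
      ⟨_, .nil, p.cons e⟩ :: (pathSplits p).map fun s => ⟨s.1, s.2.1.cons e, s.2.2⟩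

/-- The list of splits contains exactly the factorizations of the path. -/
theorem mem_pathSplits {V : Type u} [Quiver.{v} V] {a b : V} (p : Quiver.Path a b)
    (s : Σ c : V, Quiver.Path c b × Quiver.Path a c) :
    s ∈ pathSplits p ↔ s.2.2.comp s.2.1 = p := by
  induction p with
  | nil =>
    obtain ⟨c, l, r⟩ := s
    cases l with
    | nil => cases r <;> simp [pathSplits]
    | cons l e =>
      simp only [pathSplits, List.mem_singleton, Quiver.Path.comp_cons]
      constructor
      · intro h
        cases h
      · intro h
        exact absurd h (Quiver.Path.cons_ne_nil _ _)
  | cons p e ih =>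
    obtain ⟨c, l, r⟩ := s
    cases l with
    | nil =>
      constructor
      · intro h
        simp only [pathSplits, List.mem_cons, List.mem_map] at h
        rcases h with h | ⟨⟨c', l', r'⟩, _, h⟩
        · cases h
          rfl
        · cases h
      · intro h
        simp only [Quiver.Path.comp_nil] at h
        subst h
        exact List.mem_cons_self
    | @cons d _ l f =>
      constructor
      · intro h
        simp only [pathSplits, List.mem_cons, List.mem_map] at h
        rcases h with h | ⟨⟨c', l', r'⟩, hs, h⟩
        · cases h
        · cases h
          have := (ih _).1 hs
          simp at this
          simp [this]
      · intro h
        simp only [Quiver.Path.comp_cons] at h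
        cases h
        simp only [pathSplits, List.mem_cons, List.mem_map]
        exact Or.inr ⟨⟨c, l, r⟩, (ih _).2 rfl, rfl⟩

/-- No split is listed twice. -/
theorem nodup_pathSplits {V : Type u} [Quiver.{v} V] {a b : V} (p : Quiver.Path a b) :
    (pathSplits p).Nodup := by
  induction p with
  | nil => simp [pathSplits]
  | cons p e ih =>
    simp only [pathSplits, List.nodup_cons, List.mem_map, not_exists, not_and]
    refine ⟨?_, ih.map ?_⟩
    · rintro ⟨c, l, r⟩ _ h
      cases h
    · rintro ⟨c, l, r⟩ ⟨c', l', r'⟩ h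
      cases h
      rfl

theorem pathSplits_sum_coassoc {V : Type u} [Quiver.{v} V] {M : Type w} [AddCommMonoid M]
    {a b : V} (p : Quiver.Path a b)
    (f : ∀ c d : V, Quiver.Path d b → Quiver.Path c d → Quiver.Path a c → M) :
    ((pathSplits p).map fun s =>
      ((pathSplits s.2.1).map fun t => f s.1 t.1 t.2.1 t.2.2 s.2.2).sum).sum =
    ((pathSplits p).map fun s =>
      ((pathSplits s.2.2).map fun t => f t.1 s.1 s.2.1 t.2.1 t.2.2).sum).sum := by
  induction p with
  | nil => simp [pathSplits]
  | cons p e ih =>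
    have := ih fun c d l m r => f c d (l.cons e) m r
    simp only [pathSplits, List.map_cons, List.map_map, List.sum_cons, Function.comp_def,
      List.map_nil, List.sum_nil, add_zero, List.sum_map_add, this, add_assoc]

theorem pathSplits_sum_counit {V : Type u} [Quiver.{v} V] {M : Type w} [AddCommMonoid M]
    {a b : V} (p : Quiver.Path a b) (f : ∀ c : V, Quiver.Path c b → M) :
    ((pathSplits p).map fun s => if s.2.2.length = 0 then f s.1 s.2.1 else 0).sum = f a p := by
  induction p with
  | nil => simp [pathSplits]
  | cons p e ih =>
    have := ih fun c l => f c (l.cons e)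
    simp [pathSplits, Function.comp_def, this]

theorem list_sum_tmul {k : Type u} [Field k] {M N : Type*} [AddCommGroup M] [Module k M]
    [AddCommGroup N] [Module k N] {ι : Type*} (l : List ι) (f : ι → M) (n : N) :
    (l.map f).sum ⊗ₜ[k] n = (l.map fun i => f i ⊗ₜ[k] n).sum := by
  induction l with
  | nil => simp
  | cons i l ih => simp [TensorProduct.add_tmul, ih]

theorem tmul_list_sum {k : Type u} [Field k] {M N : Type*} [AddCommGroup M] [Module k M]
    [AddCommGroup N] [Module k N] {ι : Type*} (m : M) (l : List ι) (f : ι → N) :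
    m ⊗ₜ[k] (l.map f).sum = (l.map fun i => m ⊗ₜ[k] f i).sum := by
  induction l with
  | nil => simp
  | cons i l ih => simp [TensorProduct.tmul_add, ih]

/-- The linearisation `kQ` of the set of paths of a quiver `Q` with vertex set `V`. -/
def PathCoalgebra (k : Type w) [Field k] (V : Type u) [Quiver.{v} V] : Type (max u v w) :=
  QuiverPath V →₀ k

namespace PathCoalgebra

variable (k : Type w) [Field k] (V : Type u) [Quiver.{v} V]

noncomputable instance : AddCommGroup (PathCoalgebra k V) :=
  inferInstanceAs (AddCommGroup (QuiverPath V →₀ k))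

noncomputable instance : Module k (PathCoalgebra k V) :=
  inferInstanceAs (Module k (QuiverPath V →₀ k))

/-- The basis of `kQ` given by the paths. -/
noncomputable def basis : Module.Basis (QuiverPath V) k (PathCoalgebra k V) :=
  Module.Basis.ofRepr (LinearEquiv.refl k (QuiverPath V →₀ k))

/-- The counit is `1` on vertices and `0` on paths of positive length; the comultiplication of a
path is the sum of `α₂ ⊗ α₁` over its splits `α = α₂ α₁`. -/
noncomputable instance : CoalgebraStruct k (PathCoalgebra k V) where
  comul := (basis k V).constr k fun p =>
    ((pathSplits p.2.2).map fun s =>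
      basis k V ⟨s.1, p.2.1, s.2.1⟩ ⊗ₜ[k] basis k V ⟨p.1, s.1, s.2.2⟩).sum
  counit := (basis k V).constr k fun p => if p.2.2.length = 0 then 1 else 0

theorem comul_basis (p : QuiverPath V) :
    Coalgebra.comul (R := k) (basis k V p) = ((pathSplits p.2.2).map fun s =>
      basis k V ⟨s.1, p.2.1, s.2.1⟩ ⊗ₜ[k] basis k V ⟨p.1, s.1, s.2.2⟩).sum :=
  (basis k V).constr_basis k _ p

theorem counit_basis (p : QuiverPath V) :
    Coalgebra.counit (R := k) (basis k V p) = if p.2.2.length = 0 then 1 else 0 :=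
  (basis k V).constr_basis k _ p

noncomputable instance : Coalgebra k (PathCoalgebra k V) where
  coassoc := by
    refine (basis k V).ext fun p => ?_
    obtain ⟨a, b, p⟩ := p
    simp only [LinearMap.comp_apply, comul_basis, map_list_sum, List.map_map, Function.comp_def,
      LinearMap.rTensor_tmul, LinearMap.lTensor_tmul, LinearEquiv.coe_coe]
    have := pathSplits_sum_coassoc p fun c d l m r =>
      basis k V ⟨d, b, l⟩ ⊗ₜ[k] (basis k V ⟨c, d, m⟩ ⊗ₜ[k] basis k V ⟨a, c, r⟩)
    refine Eq.trans ?_ (this.trans ?_)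
    · refine congrArg List.sum (List.map_congr_left fun s _ => ?_)
      rw [list_sum_tmul, map_list_sum]
      simp [Function.comp_def]
    · refine congrArg List.sum (List.map_congr_left fun s _ => ?_)
      rw [tmul_list_sum]
  rTensor_counit_comp_comul := by
    refine (basis k V).ext fun p => ?_
    obtain ⟨a, b, p⟩ := p
    cases p <;>
      simp [comul_basis, counit_basis, pathSplits, map_list_sum, Function.comp_def]
  lTensor_counit_comp_comul := by
    refine (basis k V).ext fun p => ?_
    obtain ⟨a, b, p⟩ := p
    have := pathSplits_sum_counit p fun c l => basis k V ⟨c, b, l⟩ ⊗ₜ[k] (1 : k)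
    simp only [LinearMap.comp_apply, comul_basis, map_list_sum, List.map_map, Function.comp_def,
      LinearMap.lTensor_tmul, counit_basis, LinearMap.flip_apply, TensorProduct.mk_apply]
    rw [← this]
    congr 2
    funext s
    split_ifs <;> simp

/-- The homogeneous component `kQ_n` spanned by the paths of length `n`. -/
noncomputable def lengthPart (n : ℕ) : Submodule k (PathCoalgebra k V) :=
  Submodule.span k {x | ∃ p : QuiverPath V, p.2.2.length = n ∧ basis k V p = x}

end PathCoalgebra

/-! ### Graded Hopf algebras -/

/-- The Hopf algebra `A`, with the family `𝒜` of subspaces, is an `ℕ`-graded Hopf algebra: `A` is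
the direct sum of the `𝒜 n` and all structure maps are homogeneous of degree zero. -/
structure IsGradedHopfAlgebra (k : Type u) [Field k] {A : Type v} [Ring A] [HopfAlgebra k A]
    (𝒜 : ℕ → Submodule k A) : Prop where
  isInternal : DirectSum.IsInternal 𝒜
  one_mem : (1 : A) ∈ 𝒜 0
  mul_mem : ∀ {m n : ℕ} {a b : A}, a ∈ 𝒜 m → b ∈ 𝒜 n → a * b ∈ 𝒜 (m + n)
  comul_mem : ∀ {n : ℕ} {a : A}, a ∈ 𝒜 n → Coalgebra.comul (R := k) a ∈
    ⨆ i ∈ Finset.HasAntidiagonal.antidiagonal n,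
      LinearMap.range (TensorProduct.map (𝒜 i.1).subtype (𝒜 i.2).subtype)
  counit_eq_zero : ∀ {n : ℕ} {a : A}, n ≠ 0 → a ∈ 𝒜 n → Coalgebra.counit (R := k) a = 0
  antipode_mem : ∀ {n : ℕ} {a : A}, a ∈ 𝒜 n → HopfAlgebra.antipode k a ∈ 𝒜 n

/-- The path coalgebra `kQ` admits a graded Hopf algebra structure: it can be identified, as a
coalgebra, with a Hopf algebra which is graded by the images of the `kQ_n`. (By transport of
structure this is a multiplication, a unit and an antipode on `kQ` itself, which together with the
given comultiplication, counit and grading by path length form a graded Hopf algebra.) -/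
def AdmitsGradedHopfStructure (k : Type w) [Field k] (V : Type u) [Quiver.{v} V] : Prop :=
  ∃ (A : Type (max u v w)) (_ : Ring A) (_ : HopfAlgebra k A) (e : PathCoalgebra k V ≃ₗc[k] A),
    IsGradedHopfAlgebra k fun n =>
      (PathCoalgebra.lengthPart k V n).map (e : PathCoalgebra k V →ₗ[k] A)

/-! ### Hopf quivers -/

/-- The Hopf quiver of a group `G` with respect to a family `r` of multiplicities indexed by the
conjugacy classes of `G`: the vertices are the elements of `G`. -/
def HopfQuiver (G : Type u) [Group G] (_r : ConjClasses G → Cardinal.{v}) : Type u := G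

/-- There are `r_C` arrows from `x` to `y = c x`, where `C` is the conjugacy class of
`c = y x⁻¹`. -/
noncomputable instance (G : Type u) [Group G] (r : ConjClasses G → Cardinal.{v}) :
    Quiver.{v} (HopfQuiver G r) where
  Hom := fun x y : G => (r (ConjClasses.mk (y * x⁻¹))).out

/-- An isomorphism of quivers: a bijection on vertices and compatible bijections on arrows. -/
structure QuiverIso (V : Type u) [Quiver.{v} V] (W : Type u) [Quiver.{v} W] where
  vertexEquiv : V ≃ W
  arrowEquiv : ∀ x y : V, (x ⟶ y) ≃ (vertexEquiv x ⟶ vertexEquiv y)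

/-! From a Hopf quiver to a Hopf algebra: let `X` be the set of arrow labels, with `G` acting by
conjugation and `deg : X → G` equivariant. A path is determined by its source and its word of
labels, last arrow first, so `kQ` has basis `G × List X`, and its coproduct cuts words in two
(`ArrowLabelling.pathEquiv`, `toShuffleHopf`). The product of `(x, as)` and `(y, bs)` is the sum of
all shuffles of `as` and `bs` with source `x * y`, where a letter of `bs` is acted on by `x` and by
every letter of `as` that it stands to the left of. Equivariance of `deg` makes all these shuffles
have the same degree. Associativity is `shuffleSum_assoc`, compatibility with the coproduct is
`shuffleSum_splitSum`, and `splitSum_invWord` gives a left convolution inverse of the identity. That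
this inverse is two-sided follows because a convolution idempotent vanishing on vertices is zero.

From a graded Hopf algebra to a Hopf quiver: group-like elements are linearly independent, so those
of degree zero are exactly the vertices. They are closed under product and antipode and form a group
(`exists_group`). The arrows from `x` to `y` are a basis of the degree one elements `a` with `Δ a =
y ⊗ a + a ⊗ x` (`mem_span_arrowImage_iff`). Multiplying by vertices on both sides permutes these
spaces, so the number of arrows from `x` to `y` depends only on the conjugacy class of `y * x⁻¹`.
Comparing bases works for infinite cardinals too; part (2) then follows by checking when all
multiplicities are finite. -/

/-! ### Splits and shuffles of words -/

/-- The sum of `F p s` over all ways to write the word `l` as `p ++ s`. -/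
def splitSum {X M : Type*} [AddCommMonoid M] : List X → (List X → List X → M) → M
  | [], F => F [] []
  | a :: l, F => F [] (a :: l) + splitSum l fun p s => F (a :: p) s

section splitSum

variable {X M N : Type*} [AddCommMonoid M] [AddCommMonoid N]

theorem map_splitSum {Φ : Type*} [FunLike Φ M N] [AddMonoidHomClass Φ M N] (f : Φ) (l : List X)
    (F : List X → List X → M) : f (splitSum l F) = splitSum l fun p s => f (F p s) := by
  induction l generalizing F with
  | nil => rfl
  | cons a l ih => simp [splitSum, ih]

theorem splitSum_add (l : List X) (F F' : List X → List X → M) :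
    splitSum l (fun p s => F p s + F' p s) = splitSum l F + splitSum l F' := by
  induction l generalizing F F' with
  | nil => rfl
  | cons a l ih => simp only [splitSum, ih]; abel

theorem splitSum_zero (l : List X) : splitSum l (fun _ _ => (0 : M)) = 0 := by
  induction l with
  | nil => rfl
  | cons a l ih => simp only [splitSum, ih, add_zero]

theorem splitSum_congr {l : List X} {F F' : List X → List X → M}
    (h : ∀ p s, p ++ s = l → F p s = F' p s) : splitSum l F = splitSum l F' := by
  induction l generalizing F F' with
  | nil => exact h _ _ rfl
  | cons a l ih =>
    simp only [splitSum]
    rw [h [] (a :: l) rfl, ih fun p s hps => h _ _ (by simp [hps])]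

theorem splitSum_mem {S : Type*} [SetLike S M] [AddSubmonoidClass S M] {V : S} {l : List X}
    {F : List X → List X → M} (h : ∀ p s, p ++ s = l → F p s ∈ V) : splitSum l F ∈ V := by
  induction l generalizing F with
  | nil => exact h _ _ rfl
  | cons a l ih =>
    exact add_mem (h [] (a :: l) rfl) (ih fun p s hps => h _ _ (by simp [hps]))

/-- Both sides run over the ways to cut `l` into three consecutive pieces. -/
theorem splitSum_coassoc (l : List X) (F : List X → List X → List X → M) :
    (splitSum l fun p s => splitSum p fun q r => F q r s) =
      splitSum l fun p s => splitSum s fun q r => F p q r := by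
  induction l generalizing F with
  | nil => rfl
  | cons a l ih => simp only [splitSum, splitSum_add, ih, add_assoc]

theorem splitSum_eq_of_left_nil (l : List X) (F : List X → List X → M)
    (h : ∀ a p s, F (a :: p) s = 0) : splitSum l F = F [] l := by
  cases l <;> simp [splitSum, h, splitSum_zero]

theorem splitSum_eq_of_right_nil (l : List X) (F : List X → List X → M)
    (h : ∀ p a s, F p (a :: s) = 0) : splitSum l F = F l [] := by
  induction l generalizing F with
  | nil => rfl
  | cons a l ih => simp [splitSum, h, ih]

end splitSum

/-! ### Crossed sets and twisted shuffles -/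

/-- A set with an action of `G` and an equivariant map to `G`, on which `G` acts by conjugation. -/
class CrossedSet (G X : Type*) [Group G] extends MulAction G X where
  /-- The equivariant map to the group. -/
  deg : X → G
  deg_smul : ∀ (g : G) (a : X), deg (g • a) = g * deg a * g⁻¹

section Shuffle

variable {G X M N : Type*} [Group G] [CrossedSet G X] [AddCommMonoid M] [AddCommMonoid N]

/-- The product of the degrees of the letters of a word. -/
def wordDeg (l : List X) : G := (l.map (CrossedSet.deg (G := G))).prod

@[simp]
theorem wordDeg_nil : wordDeg ([] : List X) = (1 : G) := rfl

@[simp]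
theorem wordDeg_cons (a : X) (l : List X) :
    wordDeg (a :: l) = (CrossedSet.deg a * wordDeg l : G) := by
  simp [wordDeg]

@[simp]
theorem wordDeg_append (l l' : List X) : wordDeg (l ++ l') = (wordDeg l * wordDeg l' : G) := by
  simp [wordDeg]

/-- The sum of `F l` over all shuffles `l` of the words `as` and `bs`, in which every letter of
`bs` is acted upon by `x` and by the degree of the part of `as` to its right. -/
def shuffleSum (x : G) : List X → List X → (List X → M) → M
  | [], [], F => F []
  | a :: as, [], F => shuffleSum x as [] fun l => F (a :: l)
  | [], b :: bs, F => shuffleSum x [] bs fun l => F (x • b :: l)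
  | a :: as, b :: bs, F => (shuffleSum x as (b :: bs) fun l => F (a :: l)) +
      shuffleSum x (a :: as) bs fun l => F ((wordDeg (a :: as) * x) • b :: l)
termination_by as bs => as.length + bs.length

theorem map_shuffleSum {Φ : Type*} [FunLike Φ M N] [AddMonoidHomClass Φ M N] (f : Φ) (x : G)
    (as bs : List X) (F : List X → M) :
    f (shuffleSum x as bs F) = shuffleSum x as bs fun l => f (F l) := by
  fun_induction shuffleSum x as bs F <;> simp [shuffleSum, *, -wordDeg_cons]

theorem shuffleSum_add (x : G) (as bs : List X) (F F' : List X → M) :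
    shuffleSum x as bs (fun l => F l + F' l) = shuffleSum x as bs F + shuffleSum x as bs F' := by
  induction as generalizing bs F F' with
  | nil => induction bs generalizing F F' <;> simp [shuffleSum, *]
  | cons a as ih =>
    induction bs generalizing F F' with
    | nil => simp [shuffleSum, *]
    | cons b bs ih' => simp only [shuffleSum, ih, ih']; abel

theorem shuffleSum_zero (x : G) (as bs : List X) : shuffleSum x as bs (fun _ => (0 : M)) = 0 := by
  simpa using (map_shuffleSum (0 : M →+ M) x as bs fun _ => 0).symm

/-- All shuffles have the same degree: moving a letter `b` leftwards past a word of degree `g`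
replaces it by `g • b`, whose degree is conjugated by `g`, and `(g * deg b * g⁻¹) * g = g * deg b`.
Hence `F` and `F'` need only agree on words of that degree and of the right length. -/
theorem shuffleSum_congr {x : G} {as bs : List X} {F F' : List X → M}
    (h : ∀ l, wordDeg l = wordDeg as * x * wordDeg bs * x⁻¹ → l.length = as.length + bs.length →
      F l = F' l) : shuffleSum x as bs F = shuffleSum x as bs F' := by
  fun_induction shuffleSum x as bs F generalizing F' with
  | case1 F => simpa [shuffleSum] using h [] (by simp) rfl
  | case2 F a as ih =>
    simp only [shuffleSum]
    exact ih fun l h1 h2 => h _ (by simp [h1]) (by simp [h2])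
  | case3 F b bs ih =>
    simp only [shuffleSum]
    exact ih fun l h1 h2 => h _ (by simp [h1, CrossedSet.deg_smul, mul_assoc]) (by simp_all)
  | case4 F a as b bs ih ih' =>
    simp only [shuffleSum]
    rw [ih fun l h1 h2 => h _ (by simp [h1]; group) (by simp [h2]; omega),
      ih' fun l h1 h2 => h _ (by simp [h1, CrossedSet.deg_smul]; group) (by simp [h2]; omega)]

theorem shuffleSum_mem {S : Type*} [SetLike S M] [AddSubmonoidClass S M] {V : S} {x : G}
    {as bs : List X} {F : List X → M}
    (h : ∀ l, l.length = as.length + bs.length → F l ∈ V) : shuffleSum x as bs F ∈ V := by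
  fun_induction shuffleSum x as bs F with
  | case1 F => exact h [] rfl
  | case2 F a as ih => exact ih fun l h2 => h _ (by simp [h2])
  | case3 F b bs ih => exact ih fun l h2 => h _ (by simp_all)
  | case4 F a as b bs ih ih' =>
    exact add_mem (ih fun l h2 => h _ (by simp [h2]; omega))
      (ih' fun l h2 => h _ (by simp [h2]; omega))

@[simp]
theorem shuffleSum_nil_right (x : G) (as : List X) (F : List X → M) :
    shuffleSum x as [] F = F as := by
  induction as generalizing F <;> simp [shuffleSum, *]

@[simp]
theorem shuffleSum_one_nil_left (bs : List X) (F : List X → M) :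
    shuffleSum (1 : G) [] bs F = F bs := by
  induction bs generalizing F <;> simp [shuffleSum, *]

/-- The part of a sum over shuffles in which the first letter comes from the left word. -/
def shuffleSumLeft (x : G) : List X → List X → (List X → M) → M
  | [], _, _ => 0
  | a :: as, bs, F => shuffleSum x as bs fun l => F (a :: l)

theorem shuffleSum_cons_right (x : G) (as : List X) (b : X) (bs : List X) (F : List X → M) :
    shuffleSum x as (b :: bs) F = shuffleSumLeft x as (b :: bs) F +
      shuffleSum x as bs fun l => F ((wordDeg as * x) • b :: l) := by
  cases as <;> simp [shuffleSum, shuffleSumLeft]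

/-- Sorts by whether the first letter comes from `c :: cs`. If it does, the twist of `c` involves
only the degree of `l`, which is the same for all shuffles `l` of `as` and `bs`. -/
theorem shuffleSum_shuffleSum_cons {x y : G} {as bs : List X} {c : X} {cs : List X}
    {F : List X → M} :
    (shuffleSum x as bs fun l => shuffleSum (x * y) l (c :: cs) F) =
      (shuffleSum x as bs fun l => shuffleSumLeft (x * y) l (c :: cs) F) +
      shuffleSum x as bs fun l => shuffleSum (x * y) l cs fun l =>
        F ((wordDeg as * x * wordDeg bs * y) • c :: l) := by
  rw [← shuffleSum_add]
  refine shuffleSum_congr fun l hl _ => ?_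
  rw [shuffleSum_cons_right, hl]
  simp [mul_assoc]

/-- Both sides are the sum over shuffles of three words. Induction on the total length, sorting by
which of the three words supplies the first letter; the twists agree by the constancy of the degree.
-/
theorem shuffleSum_assoc (x y : G) (as bs cs : List X) (F : List X → M) :
    (shuffleSum x as bs fun l => shuffleSum (x * y) l cs F) =
      shuffleSum y bs cs fun l => shuffleSum x as l F := by
  match cs with
  | [] => simp
  | c :: cs =>
    have hc := shuffleSum_assoc x y as bs cs
    rw [shuffleSum_shuffleSum_cons, hc]
    match as, bs with
    | [], [] => simp [shuffleSum, shuffleSumLeft, mul_smul]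
    | a :: as, [] =>
      have ha := shuffleSum_assoc x y as [] (c :: cs)
      simp only [shuffleSum, shuffleSumLeft, shuffleSum_add, smul_smul, wordDeg_nil,
        mul_one, wordDeg_cons, mul_assoc] at ha ⊢
      rw [ha]
    | [], b :: bs =>
      have hb := shuffleSum_assoc x y [] bs (c :: cs)
      simp only [shuffleSum, shuffleSumLeft, smul_smul, wordDeg_nil, one_mul, wordDeg_cons,
        mul_assoc] at hb ⊢
      rw [hb]
    | a :: as, b :: bs =>
      have ha := shuffleSum_assoc x y as (b :: bs) (c :: cs)
      have hb := shuffleSum_assoc x y (a :: as) bs (c :: cs)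
      simp only [shuffleSum, shuffleSumLeft, shuffleSum_add, smul_smul, wordDeg_cons,
        mul_assoc] at ha hb ⊢
      rw [ha, hb]
      abel
termination_by as.length + bs.length + cs.length

/-- Cutting a shuffle in two cuts `as` and `bs`, and each half is a shuffle of the corresponding
pieces. Letters of `bs₂` also stand to the left of all of `as₁`, whence the twist `wordDeg as₁ * x`.
-/
theorem shuffleSum_splitSum (x : G) (as bs : List X) (F : List X → List X → M) :
    (shuffleSum x as bs fun l => splitSum l F) =
      splitSum as fun as₂ as₁ => splitSum bs fun bs₂ bs₁ =>
        shuffleSum (wordDeg as₁ * x) as₂ bs₂ fun l₂ => shuffleSum x as₁ bs₁ fun l₁ => F l₂ l₁ := by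
  induction as generalizing bs F with
  | nil =>
    induction bs generalizing F with
    | nil => simp [splitSum]
    | cons b bs ih =>
      simp only [splitSum] at ih
      simp only [splitSum, shuffleSum, shuffleSum_add, ih, wordDeg_nil, one_mul]
  | cons a as ih =>
    induction bs generalizing F with
    | nil =>
      have := ih [] fun p s => F (a :: p) s
      simp_all [splitSum]
    | cons b bs ih' =>
      have h1 := ih (b :: bs) fun p s => F (a :: p) s
      have h2 := ih' fun p s => F ((wordDeg (a :: as) * x) • b :: p) s
      -- When `b` comes first it is twisted by all of `a :: as`, wherever `as` is cut, since `as₂ ++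
      -- as₁ = as`.
      have h3 : (splitSum as fun as₂ as₁ => splitSum bs fun bs₂ bs₁ =>
          shuffleSum (wordDeg as₁ * x) (a :: as₂) bs₂ fun l₂ => shuffleSum x as₁ bs₁ fun l₁ =>
            F ((wordDeg (a :: as₂) * (wordDeg as₁ * x)) • b :: l₂) l₁) =
          splitSum as fun as₂ as₁ => splitSum bs fun bs₂ bs₁ =>
          shuffleSum (wordDeg as₁ * x) (a :: as₂) bs₂ fun l₂ => shuffleSum x as₁ bs₁ fun l₁ =>
            F ((wordDeg (a :: as) * x) • b :: l₂) l₁ := by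
        refine splitSum_congr fun p s h => ?_
        rw [← h]
        simp only [wordDeg_cons, wordDeg_append, mul_assoc]
      simp only [splitSum, shuffleSum, shuffleSum_add, splitSum_add,
        shuffleSum_nil_right] at h1 h2 h3 ⊢
      rw [h1, h2, h3]
      abel

/-- The labels of the inverse of the path with source `x` and labels `l`. -/
def invWord (x : G) : List X → List X
  | [] => []
  | a :: l => invWord x l ++ [(wordDeg (a :: l) * x)⁻¹ • a]

@[simp]
theorem length_invWord (x : G) (l : List X) : (invWord x l).length = l.length := by
  induction l <;> simp [invWord, *]

/-- For `acc = []` this says that the antipode convolved with the identity kills nonempty words. The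
accumulator lets the cancellation run by induction: `invWord` appends at its right end, so letters
inverted earlier collect in `acc`. If both words were empty, the left side would be `F []` and the
right side `0`. -/
theorem splitSum_invWord {M : Type*} [AddCommGroup M] {x z : G} {l acc : List X}
    (h : wordDeg acc * z = (wordDeg l * x)⁻¹) (hne : l ≠ [] ∨ acc ≠ []) (F : List X → M) :
    (splitSum l fun p s => (-1 : ℤ) ^ p.length •
      shuffleSum z (invWord (wordDeg s * x) p ++ acc) s F) = shuffleSumLeft z acc l F := by
  induction l generalizing acc with
  | nil => cases acc <;> simp_all [splitSum, invWord, shuffleSumLeft]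
  | cons a l ih =>
    have h' : wordDeg ((wordDeg (a :: l) * x)⁻¹ • a :: acc) * z = (wordDeg l * x)⁻¹ := by
      rw [wordDeg_cons, mul_assoc, h, CrossedSet.deg_smul, wordDeg_cons]
      group
    have := ih h' (by simp)
    simp only [splitSum, List.length_nil, pow_zero, one_smul, invWord, List.nil_append,
      List.length_cons, pow_succ, mul_neg, mul_one, neg_smul]
    -- In the term `p = []`, the shuffles that start with a letter of `acc` are the claimed result.
    -- By `h`, those that start with the twisted `a` carry exactly the letter that `invWord` would
    -- put in front of `acc`; they cancel against all the terms with `p` nonempty, which have the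
    -- opposite sign.
    rw [shuffleSum_cons_right, h, add_assoc, add_eq_left]
    simp only [shuffleSumLeft] at this
    rw [← this, ← splitSum_add, ← splitSum_zero l]
    refine splitSum_congr fun p s h => ?_
    rw [← h, add_eq_zero_iff_neg_eq]
    simp [mul_assoc]

end Shuffle

section

variable {k X M N : Type*} [Field k] [AddCommGroup M] [AddCommGroup N] [Module k M] [Module k N]

theorem splitSum_tmul (l : List X) (F : List X → List X → M) (n : N) :
    splitSum l F ⊗ₜ[k] n = splitSum l fun p s => F p s ⊗ₜ[k] n :=
  map_splitSum ((TensorProduct.mk k M N).flip n) l F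

theorem tmul_splitSum (l : List X) (m : M) (F : List X → List X → N) :
    m ⊗ₜ[k] splitSum l F = splitSum l fun p s => m ⊗ₜ[k] F p s :=
  map_splitSum (TensorProduct.mk k M N m) l F

theorem splitSum_mul {R : Type*} [Ring R] (l : List X) (F : List X → List X → R) (b : R) :
    splitSum l F * b = splitSum l fun p s => F p s * b :=
  map_splitSum (AddMonoidHom.mulRight b) l F

theorem mul_splitSum {R : Type*} [Ring R] (l : List X) (b : R) (F : List X → List X → R) :
    b * splitSum l F = splitSum l fun p s => b * F p s :=
  map_splitSum (AddMonoidHom.mulLeft b) l F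

variable {G : Type*} [Group G] [CrossedSet G X]

theorem shuffleSum_tmul (x : G) (as bs : List X) (F : List X → M) (n : N) :
    shuffleSum x as bs F ⊗ₜ[k] n = shuffleSum x as bs fun l => F l ⊗ₜ[k] n :=
  map_shuffleSum ((TensorProduct.mk k M N).flip n) x as bs F

theorem tmul_shuffleSum (x : G) (as bs : List X) (m : M) (F : List X → N) :
    m ⊗ₜ[k] shuffleSum x as bs F = shuffleSum x as bs fun l => m ⊗ₜ[k] F l :=
  map_shuffleSum (TensorProduct.mk k M N m) x as bs F

end

/-! ### The Hopf algebra of shuffles of a crossed set -/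

/-- The vector space with basis the pairs of an element of `G` and a word in the letters `X`. -/
def ShuffleHopf (k G X : Type*) [Field k] [Group G] [CrossedSet G X] : Type _ :=
  G × List X →₀ k

namespace ShuffleHopf

variable (k G X : Type*) [Field k] [Group G] [CrossedSet G X]

noncomputable instance : AddCommGroup (ShuffleHopf k G X) :=
  inferInstanceAs (AddCommGroup (G × List X →₀ k))

noncomputable instance : Module k (ShuffleHopf k G X) :=
  inferInstanceAs (Module k (G × List X →₀ k))

/-- The basis of pairs of an element of `G` and a word. -/
noncomputable def basis : Module.Basis (G × List X) k (ShuffleHopf k G X) :=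
  Module.Basis.ofRepr (LinearEquiv.refl k (G × List X →₀ k))

/-- The shuffle product as a bilinear map. -/
noncomputable def mulLinear :
    ShuffleHopf k G X →ₗ[k] ShuffleHopf k G X →ₗ[k] ShuffleHopf k G X :=
  (basis k G X).constr k fun p => (basis k G X).constr k fun q =>
    shuffleSum p.1 p.2 q.2 fun l => basis k G X (p.1 * q.1, l)

noncomputable instance : Mul (ShuffleHopf k G X) := ⟨fun a b => mulLinear k G X a b⟩

noncomputable instance : One (ShuffleHopf k G X) := ⟨basis k G X (1, [])⟩

theorem one_def : (1 : ShuffleHopf k G X) = basis k G X (1, []) := rfl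

theorem mul_def (a b : ShuffleHopf k G X) : a * b = mulLinear k G X a b := rfl

theorem basis_mul_basis (p q : G × List X) :
    basis k G X p * basis k G X q =
      shuffleSum p.1 p.2 q.2 fun l => basis k G X (p.1 * q.1, l) := by
  simp [mul_def, mulLinear, Module.Basis.constr_basis]

variable {k G X} in
@[elab_as_elim]
theorem induction_basis {P : ShuffleHopf k G X → Prop} (a : ShuffleHopf k G X)
    (add : ∀ a b, P a → P b → P (a + b)) (smul : ∀ (r : k) a, P a → P (r • a))
    (basis : ∀ p, P (basis k G X p)) : P a := by
  have ha : a ∈ Submodule.span k (Set.range (ShuffleHopf.basis k G X)) := by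
    simp [Module.Basis.span_eq]
  induction ha using Submodule.span_induction with
  | mem x hx =>
    obtain ⟨p, rfl⟩ := hx
    exact basis p
  | zero => simpa using smul 0 _ (basis (1, []))
  | add a b _ _ ha hb => exact add a b ha hb
  | smul r a _ ha => exact smul r a ha

theorem shuffleProduct_assoc (a b c : ShuffleHopf k G X) : a * b * c = a * (b * c) := by
  simp only [mul_def]
  induction a using induction_basis with
  | add a a' h h' => simp only [map_add, LinearMap.add_apply, h, h']
  | smul r a h => simp only [map_smul, LinearMap.smul_apply, h]
  | basis p =>
  induction b using induction_basis with
  | add a a' h h' => simp only [map_add, LinearMap.add_apply, h, h']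
  | smul r a h => simp only [map_smul, LinearMap.smul_apply, h]
  | basis q =>
  induction c using induction_basis with
  | add a a' h h' => simp only [map_add, h, h']
  | smul r a h => simp only [map_smul, h]
  | basis r =>
    simp only [← mul_def, basis_mul_basis]
    refine (map_shuffleSum ((mulLinear k G X).flip (basis k G X r)) _ _ _ _).trans
      (Eq.trans ?_ (map_shuffleSum (mulLinear k G X (basis k G X p)) _ _ _ _).symm)
    simp only [LinearMap.flip_apply, ← mul_def, basis_mul_basis, mul_assoc]
    exact shuffleSum_assoc _ _ _ _ _ _

noncomputable instance : Ring (ShuffleHopf k G X) where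
  __ := (inferInstance : AddCommGroup (ShuffleHopf k G X))
  left_distrib a b c := map_add _ b c
  right_distrib a b c := by simp only [mul_def, map_add, LinearMap.add_apply]
  zero_mul a := by simp only [mul_def, map_zero, LinearMap.zero_apply]
  mul_zero a := map_zero _
  mul_assoc := shuffleProduct_assoc k G X
  one_mul a := by
    have : mulLinear k G X (basis k G X (1, [])) = LinearMap.id :=
      (basis k G X).ext fun q => by
        rw [← mul_def, basis_mul_basis]
        simp
    exact LinearMap.congr_fun this a
  mul_one a := by
    have : (mulLinear k G X).flip (basis k G X (1, [])) = LinearMap.id :=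
      (basis k G X).ext fun q => by
        rw [LinearMap.flip_apply, ← mul_def, basis_mul_basis]
        simp
    exact LinearMap.congr_fun this a

noncomputable instance : Algebra k (ShuffleHopf k G X) :=
  Algebra.ofModule (fun r a b => by simp only [mul_def, map_smul, LinearMap.smul_apply])
    fun r a b => by simp only [mul_def, map_smul]

/-- A pair `(x, l)` stands for the path with source `x` and labels `l`. The later part `l₂` starts
where `l₁` ends, at `wordDeg l₁ * x`. -/
noncomputable instance : CoalgebraStruct k (ShuffleHopf k G X) where
  comul := (basis k G X).constr k fun p => splitSum p.2 fun l₂ l₁ =>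
    basis k G X (wordDeg l₁ * p.1, l₂) ⊗ₜ[k] basis k G X (p.1, l₁)
  counit := (basis k G X).constr k fun p => if p.2 = [] then 1 else 0

theorem comul_basis (p : G × List X) :
    Coalgebra.comul (R := k) (basis k G X p) = splitSum p.2 fun l₂ l₁ =>
      basis k G X (wordDeg l₁ * p.1, l₂) ⊗ₜ[k] basis k G X (p.1, l₁) :=
  (basis k G X).constr_basis k _ p

theorem counit_basis (p : G × List X) :
    Coalgebra.counit (R := k) (basis k G X p) = if p.2 = [] then 1 else 0 :=
  (basis k G X).constr_basis k _ p

noncomputable instance : Coalgebra k (ShuffleHopf k G X) where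
  coassoc := by
    refine (basis k G X).ext fun p => ?_
    simp only [LinearMap.comp_apply, LinearEquiv.coe_coe, comul_basis, map_splitSum,
      LinearMap.rTensor_tmul, LinearMap.lTensor_tmul, splitSum_tmul, tmul_splitSum,
      TensorProduct.assoc_tmul]
    rw [splitSum_coassoc]
    refine splitSum_congr fun p s _ => splitSum_congr fun q r h => ?_
    rw [← h, wordDeg_append, mul_assoc]
  rTensor_counit_comp_comul := by
    refine (basis k G X).ext fun p => ?_
    rw [LinearMap.comp_apply, comul_basis, map_splitSum, splitSum_eq_of_left_nil]
    · simp [counit_basis]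
    · simp [counit_basis]
  lTensor_counit_comp_comul := by
    refine (basis k G X).ext fun p => ?_
    rw [LinearMap.comp_apply, comul_basis, map_splitSum, splitSum_eq_of_right_nil]
    · simp [counit_basis]
    · simp [counit_basis]

theorem comul_mul_basis (p q : G × List X) :
    Coalgebra.comul (R := k) (basis k G X p * basis k G X q) =
      Coalgebra.comul (R := k) (basis k G X p) * Coalgebra.comul (R := k) (basis k G X q) := by
  simp only [basis_mul_basis, map_shuffleSum, comul_basis, splitSum_mul]
  simp only [mul_splitSum, Algebra.TensorProduct.tmul_mul_tmul, basis_mul_basis, shuffleSum_tmul]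
  simp only [tmul_shuffleSum]
  rw [shuffleSum_splitSum]
  refine splitSum_congr fun p s _ => ?_
  refine splitSum_congr fun q r _ => ?_
  refine shuffleSum_congr fun l _ _ => ?_
  refine shuffleSum_congr fun l' h _ => ?_
  rw [h]
  congr 3
  group

theorem counit_mul_basis (p q : G × List X) :
    Coalgebra.counit (R := k) (basis k G X p * basis k G X q) =
      Coalgebra.counit (R := k) (basis k G X p) * Coalgebra.counit (R := k) (basis k G X q) := by
  simp only [basis_mul_basis, map_shuffleSum, counit_basis]
  obtain ⟨x, as⟩ := p
  obtain ⟨y, bs⟩ := q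
  rw [shuffleSum_congr (F' := fun _ => if as = [] ∧ bs = [] then 1 else 0)]
  · cases as <;> cases bs <;> simp [shuffleSum_zero]
  · intro l _ h
    simp [← List.length_eq_zero_iff, h]

noncomputable instance : Bialgebra k (ShuffleHopf k G X) :=
  Bialgebra.mk' k _ (by simp [one_def, counit_basis])
    (fun {a b} => by
      induction a using induction_basis with
      | add a a' h h' => simp only [add_mul, map_add, h, h']
      | smul r a h => simp only [smul_mul_assoc, map_smul, h]
      | basis p =>
      induction b using induction_basis with
      | add a a' h h' => simp only [mul_add, map_add, h, h']
      | smul r a h => simp only [mul_smul_comm, map_smul, h]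
      | basis q => exact counit_mul_basis k G X p q)
    (by simp [one_def, comul_basis, splitSum, Algebra.TensorProduct.one_def])
    (fun {a b} => by
      induction a using induction_basis with
      | add a a' h h' => simp only [add_mul, map_add, h, h']
      | smul r a h => simp only [smul_mul_assoc, map_smul, h]
      | basis p =>
      induction b using induction_basis with
      | add a a' h h' => simp only [mul_add, map_add, h, h']
      | smul r a h => simp only [mul_smul_comm, map_smul, h]
      | basis q => exact comul_mul_basis k G X p q)

/-- The antipode. -/
noncomputable def antipode : ShuffleHopf k G X →ₗ[k] ShuffleHopf k G X :=
  (basis k G X).constr k fun p =>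
    (-1 : ℤ) ^ p.2.length • basis k G X ((wordDeg p.2 * p.1)⁻¹, invWord p.1 p.2)

theorem antipode_basis (p : G × List X) : antipode k G X (basis k G X p) =
    (-1 : ℤ) ^ p.2.length • basis k G X ((wordDeg p.2 * p.1)⁻¹, invWord p.1 p.2) :=
  (basis k G X).constr_basis k _ p

open WithConv in
theorem antipode_mul_id :
    toConv (antipode k G X) * toConv (LinearMap.id (R := k) (M := ShuffleHopf k G X)) = 1 := by
  apply ofConv_injective
  refine (basis k G X).ext fun p => ?_
  obtain ⟨x, l⟩ := p
  change (toConv (antipode k G X) *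
    toConv (LinearMap.id (R := k) (M := ShuffleHopf k G X))) _ =
    (1 : WithConv (ShuffleHopf k G X →ₗ[k] ShuffleHopf k G X)) _
  rw [LinearMap.convMul_apply, LinearMap.convOne_apply, comul_basis, counit_basis, map_splitSum,
    map_splitSum]
  simp only [TensorProduct.map_tmul, LinearMap.mul'_apply, antipode_basis, smul_mul_assoc,
    basis_mul_basis, LinearMap.id_apply]
  cases l with
  | nil => simp [splitSum, invWord, Algebra.algebraMap_eq_smul_one, one_def]
  | cons a l =>
    have := splitSum_invWord (x := x) (z := (wordDeg (a :: l) * x)⁻¹) (l := a :: l) (acc := [])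
      (by simp) (by simp) fun l' => basis k G X ((wordDeg (a :: l) * x)⁻¹ * x, l')
    simp only [List.append_nil, shuffleSumLeft] at this
    simp only [reduceCtorEq, if_false, map_zero]
    rw [← this]
    refine splitSum_congr fun p s h => ?_
    rw [← h]
    simp [mul_assoc]

open WithConv in
-- Expand `f = f * f` on a word cut as `p ++ s`: if `s` is empty the second factor vanishes by
-- hypothesis, and otherwise `p` is shorter, so the first factor vanishes by induction.
theorem eq_zero_of_isIdempotentElem {f : WithConv (ShuffleHopf k G X →ₗ[k] ShuffleHopf k G X)}
    (hf : IsIdempotentElem f) (h0 : ∀ x, f (basis k G X (x, [])) = 0) : f = 0 := by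
  have key : ∀ n, ∀ (x : G) (l : List X), l.length = n → f (basis k G X (x, l)) = 0 := by
    intro n
    induction n using Nat.strong_induction_on with
    | _ n ih =>
      intro x l hl
      rw [← hf, LinearMap.convMul_apply, comul_basis, map_splitSum, map_splitSum,
        ← splitSum_zero l]
      refine splitSum_congr fun p s h => ?_
      rw [TensorProduct.map_tmul, LinearMap.mul'_apply]
      cases s with
      | nil =>
        change _ * f (basis k G X (x, [])) = 0
        rw [h0, mul_zero]
      | cons a s =>
        change f (basis k G X (_, p)) * _ = 0
        rw [ih p.length (by dsimp at h; subst h hl; simp) _ p rfl, zero_mul]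
  apply ofConv_injective
  exact (basis k G X).ext fun p => key _ p.1 p.2 rfl

open WithConv in
theorem id_mul_antipode :
    toConv (LinearMap.id (R := k) (M := ShuffleHopf k G X)) * toConv (antipode k G X) = 1 := by
  have h := antipode_mul_id k G X
  set S := toConv (antipode k G X)
  set I := toConv (LinearMap.id (R := k) (M := ShuffleHopf k G X))
  -- A left inverse `S` makes `I * S` idempotent, hence also `1 - I * S`. The latter vanishes on
  -- vertices, where `S` is group inversion, so it is zero.
  have hi : IsIdempotentElem (I * S) := by
    rw [IsIdempotentElem, mul_assoc, ← mul_assoc S, h, one_mul]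
  have := eq_zero_of_isIdempotentElem k G X hi.one_sub fun x => by
    change (1 : WithConv (ShuffleHopf k G X →ₗ[k] ShuffleHopf k G X)) _ - (I * S) _ = 0
    rw [LinearMap.convMul_apply, LinearMap.convOne_apply, comul_basis, counit_basis]
    simp [splitSum, I, S, antipode_basis, invWord, basis_mul_basis,
      Algebra.algebraMap_eq_smul_one, one_def]
  exact (sub_eq_zero.1 this).symm

noncomputable instance : HopfAlgebra k (ShuffleHopf k G X) where
  antipode := antipode k G X
  mul_antipode_rTensor_comul := congrArg WithConv.ofConv (antipode_mul_id k G X)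
  mul_antipode_lTensor_comul := congrArg WithConv.ofConv (id_mul_antipode k G X)

end ShuffleHopf

/-! ### The grading by word length -/

namespace ShuffleHopf

variable (k G X : Type*) [Field k] [Group G] [CrossedSet G X]

/-- The span of the basis elements given by words of length `n`. -/
noncomputable def lengthPart (n : ℕ) : Submodule k (ShuffleHopf k G X) :=
  Submodule.span k (basis k G X '' {p | p.2.length = n})

variable {k G X} in
theorem basis_mem_lengthPart {p : G × List X} {n : ℕ} (h : p.2.length = n) :
    basis k G X p ∈ lengthPart k G X n :=
  Submodule.subset_span ⟨p, h, rfl⟩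

theorem isInternal_lengthPart : DirectSum.IsInternal (lengthPart k G X) := by
  rw [DirectSum.isInternal_submodule_iff_iSupIndep_and_iSup_eq_top]
  constructor
  · intro n
    simp only [lengthPart, ← Submodule.span_iUnion, ← Set.image_iUnion]
    refine (basis k G X).linearIndependent.disjoint_span_image ?_
    rw [Set.disjoint_left]
    rintro p hp hp'
    simp only [Set.mem_iUnion, Set.mem_ofPred_eq] at hp hp'
    obtain ⟨m, hm, h⟩ := hp'
    exact hm (h.symm.trans hp)
  · rw [eq_top_iff, ← (basis k G X).span_eq, Submodule.span_le]
    rintro _ ⟨p, rfl⟩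
    exact Submodule.mem_iSup_of_mem p.2.length (basis_mem_lengthPart rfl)

variable {k G X} in
theorem lengthPart_induction {n : ℕ} {N : Type*} [AddCommGroup N] [Module k N]
    (f : ShuffleHopf k G X →ₗ[k] N) {W : Submodule k N}
    (h : ∀ p : G × List X, p.2.length = n → f (basis k G X p) ∈ W) {a : ShuffleHopf k G X}
    (ha : a ∈ lengthPart k G X n) : f a ∈ W := by
  have : lengthPart k G X n ≤ W.comap f := by
    rw [lengthPart, Submodule.span_le]
    rintro _ ⟨p, hp, rfl⟩
    exact h p hp
  exact this ha

theorem isGradedHopfAlgebra_lengthPart : IsGradedHopfAlgebra k (lengthPart k G X) where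
  isInternal := isInternal_lengthPart k G X
  one_mem := basis_mem_lengthPart rfl
  mul_mem {m n a b} ha hb := by
    refine lengthPart_induction (LinearMap.mulLeft k a) (fun q hq => ?_) hb
    refine lengthPart_induction (LinearMap.mulRight k (basis k G X q)) (fun p hp => ?_) ha
    rw [LinearMap.mulRight_apply, basis_mul_basis]
    exact shuffleSum_mem fun l hl => basis_mem_lengthPart (by simp [hl, hp, hq])
  comul_mem {n a} ha := by
    refine lengthPart_induction _ (fun p hp => ?_) ha
    rw [comul_basis]
    refine splitSum_mem fun l₂ l₁ h => ?_
    refine Submodule.mem_iSup_of_mem (l₂.length, l₁.length) (Submodule.mem_iSup_of_mem ?_ ?_)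
    · simp [← hp, ← h]
    · exact ⟨⟨_, basis_mem_lengthPart rfl⟩ ⊗ₜ ⟨_, basis_mem_lengthPart rfl⟩, rfl⟩
  counit_eq_zero {n a} hn ha := by
    refine (Submodule.mem_bot k).1 (lengthPart_induction _ (fun p hp => ?_) ha)
    rw [counit_basis, if_neg]
    · exact zero_mem _
    · rintro h
      simp [h] at hp
      exact hn hp.symm
  antipode_mem {n a} ha := by
    refine lengthPart_induction _ (fun p hp => ?_) ha
    refine (antipode_basis k G X p).symm ▸ zsmul_mem (basis_mem_lengthPart ?_) _
    simp [hp]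

end ShuffleHopf

/-! ### Paths as words -/

/-- A labelling of the arrows of a quiver by a crossed set, where the arrows from `y` to `z` are
labelled bijectively by the letters of degree `z * y⁻¹`. -/
structure ArrowLabelling (V : Type u) [Quiver.{v} V] (G X : Type*) [Group G]
    [CrossedSet G X] where
  /-- The vertices are the elements of the group. -/
  vertex : V ≃ G
  /-- The labels of the arrows from `y` to `z`. -/
  label : ∀ y z : V, (y ⟶ z) ≃ {a : X // CrossedSet.deg a = vertex z * (vertex y)⁻¹}

namespace ArrowLabelling

variable {V : Type u} [Quiver.{v} V] {G X : Type*} [Group G] [CrossedSet G X]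
  (L : ArrowLabelling V G X)

/-- The word of labels of a path. -/
def word {a : V} : ∀ {b : V}, Quiver.Path a b → List X
  | _, .nil => []
  | _, .cons p e => (L.label _ _ e).1 :: word p

theorem wordDeg_word {a b : V} (p : Quiver.Path a b) :
    wordDeg (L.word p) * L.vertex a = L.vertex b := by
  induction p with
  | nil => simp [word]
  | cons p e ih => simp [word, mul_assoc, ih, (L.label _ _ e).2]

theorem length_word {a b : V} (p : Quiver.Path a b) : (L.word p).length = p.length := by
  induction p <;> simp [word, *]

theorem sum_pathSplits {M : Type*} [AddCommMonoid M] {a b : V} (p : Quiver.Path a b)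
    (F : List X → List X → M) :
    ((pathSplits p).map fun s => F (L.word s.2.1) (L.word s.2.2)).sum =
      splitSum (L.word p) F := by
  induction p generalizing F with
  | nil => simp [pathSplits, word, splitSum]
  | cons p e ih => simp [pathSplits, word, splitSum, ← ih, Function.comp_def]

/-- The label of an arrow determines its degree, so together with the starting vertex it determines
the end vertex, and then the arrow itself. -/
theorem word_injective {a b b' : V} (p : Quiver.Path a b) (q : Quiver.Path a b')
    (h : L.word p = L.word q) : (⟨b, p⟩ : Σ b, Quiver.Path a b) = ⟨b', q⟩ := by
  induction p generalizing b' with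
  | nil => cases q with
    | nil => rfl
    | cons q f => simp [word] at h
  | @cons c d p e ih => cases q with
    | nil => simp [word] at h
    | @cons c' _ q f =>
      simp only [word, List.cons.injEq] at h
      cases ih q h.2
      have : d = b' := by
        apply L.vertex.injective
        have := (L.label _ _ e).2
        rw [h.1, (L.label _ _ f).2] at this
        simpa using this.symm
      subst this
      rw [(L.label _ _).injective (Subtype.ext h.1)]

theorem exists_word_eq (a : V) (l : List X) : ∃ (b : V) (p : Quiver.Path a b), L.word p = l := by
  induction l with
  | nil => exact ⟨a, .nil, rfl⟩
  | cons x l ih =>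
    obtain ⟨b, p, rfl⟩ := ih
    refine ⟨L.vertex.symm (CrossedSet.deg x * L.vertex b), p.cons ((L.label _ _).symm ⟨x, ?_⟩), ?_⟩
    · simp
    · simp [word]

/-- Paths correspond to pairs consisting of the source and the word of labels. -/
noncomputable def pathEquiv : QuiverPath V ≃ G × List X :=
  Equiv.ofBijective (fun p => (L.vertex p.1, L.word p.2.2)) <| by
    constructor
    · rintro ⟨a, b, p⟩ ⟨a', b', q⟩ h
      simp only [Prod.mk.injEq, EmbeddingLike.apply_eq_iff_eq] at h
      obtain ⟨rfl, h⟩ := h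
      rw [L.word_injective p q h]
    · rintro ⟨x, l⟩
      obtain ⟨b, p, h⟩ := L.exists_word_eq (L.vertex.symm x) l
      exact ⟨⟨_, b, p⟩, by simp [h]⟩

theorem pathEquiv_apply {a b : V} (p : Quiver.Path a b) :
    L.pathEquiv ⟨a, b, p⟩ = (L.vertex a, L.word p) := rfl

variable (k : Type w) [Field k]

/-- The linear isomorphism from the path coalgebra to the Hopf algebra of shuffles. -/
noncomputable def toShuffleHopfLinear : PathCoalgebra k V ≃ₗ[k] ShuffleHopf k G X :=
  (PathCoalgebra.basis k V).equiv (ShuffleHopf.basis k G X) L.pathEquiv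

theorem toShuffleHopfLinear_basis {a b : V} (p : Quiver.Path a b) :
    L.toShuffleHopfLinear k (PathCoalgebra.basis k V ⟨a, b, p⟩) =
      ShuffleHopf.basis k G X (L.vertex a, L.word p) := by
  rw [toShuffleHopfLinear, Module.Basis.equiv_apply, pathEquiv_apply]

/-- The isomorphism of coalgebras from the path coalgebra to the Hopf algebra of shuffles. -/
noncomputable def toShuffleHopf : PathCoalgebra k V ≃ₗc[k] ShuffleHopf k G X where
  __ := L.toShuffleHopfLinear k
  counit_comp := by
    refine (PathCoalgebra.basis k V).ext fun ⟨a, b, p⟩ => ?_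
    change Coalgebra.counit (R := k) (L.toShuffleHopfLinear k _) = _
    rw [toShuffleHopfLinear_basis, ShuffleHopf.counit_basis, PathCoalgebra.counit_basis]
    simp [← List.length_eq_zero_iff, length_word]
  map_comp_comul := by
    refine (PathCoalgebra.basis k V).ext fun ⟨a, b, p⟩ => ?_
    change TensorProduct.map _ _ (Coalgebra.comul (R := k) _) =
      Coalgebra.comul (R := k) (L.toShuffleHopfLinear k _)
    rw [toShuffleHopfLinear_basis, ShuffleHopf.comul_basis, PathCoalgebra.comul_basis,
      map_list_sum, List.map_map, ← sum_pathSplits]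
    refine congrArg List.sum (List.map_congr_left fun s _ => ?_)
    change L.toShuffleHopfLinear k _ ⊗ₜ L.toShuffleHopfLinear k _ = _
    rw [toShuffleHopfLinear_basis, toShuffleHopfLinear_basis, wordDeg_word]

theorem map_lengthPart (n : ℕ) :
    (PathCoalgebra.lengthPart k V n).map (L.toShuffleHopf k : PathCoalgebra k V →ₗ[k] _) =
      ShuffleHopf.lengthPart k G X n := by
  rw [PathCoalgebra.lengthPart, Submodule.map_span, ShuffleHopf.lengthPart]
  congr 1
  ext x
  constructor
  · rintro ⟨_, ⟨⟨a, b, p⟩, hp, rfl⟩, rfl⟩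
    exact ⟨_, (L.length_word p).trans hp, (L.toShuffleHopfLinear_basis k p).symm⟩
  · rintro ⟨q, hq, rfl⟩
    obtain ⟨⟨a, b, p⟩, rfl⟩ := L.pathEquiv.surjective q
    exact ⟨_, ⟨⟨a, b, p⟩, (L.length_word p).symm.trans hq, rfl⟩, L.toShuffleHopfLinear_basis k p⟩

end ArrowLabelling

theorem ArrowLabelling.admitsGradedHopfStructure {V : Type u} [Quiver.{v} V] {G : Type u}
    {X : Type (max u v)} [Group G] [CrossedSet G X] (L : ArrowLabelling V G X)
    (k : Type w) [Field k] : AdmitsGradedHopfStructure k V := by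
  refine ⟨ShuffleHopf k G X, inferInstance, inferInstance, L.toShuffleHopf k, ?_⟩
  convert ShuffleHopf.isGradedHopfAlgebra_lengthPart k G X using 1
  exact funext (L.map_lengthPart k)

/-! ### The labels of the arrows of a Hopf quiver -/

/-- The labels of the arrows of a Hopf quiver: elements of the group with multiplicities. -/
def RamificationLabel (G : Type u) [Group G] (r : ConjClasses G → Cardinal.{v}) : Type (max u v) :=
  Σ C : ConjClasses G, C.carrier × (r C).out

instance (G : Type u) [Group G] (r : ConjClasses G → Cardinal.{v}) :
    CrossedSet G (RamificationLabel G r) where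
  smul g a := ⟨a.1, ⟨g * a.2.1 * g⁻¹, by
    refine ConjClasses.mem_carrier_iff_mk_eq.2
      (Eq.trans ?_ (ConjClasses.mem_carrier_iff_mk_eq.1 a.2.1.2))
    exact ConjClasses.mk_eq_mk_iff_isConj.2 (isConj_iff.2 ⟨g, rfl⟩).symm⟩, a.2.2⟩
  one_smul a := Sigma.ext rfl (heq_of_eq (Prod.ext (Subtype.ext (by
    change 1 * a.2.1.1 * 1⁻¹ = _; simp)) rfl))
  mul_smul g h a := Sigma.ext rfl (heq_of_eq (Prod.ext (Subtype.ext (by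
    change g * h * a.2.1.1 * (g * h)⁻¹ = g * (h * a.2.1.1 * h⁻¹) * g⁻¹; group)) rfl))
  deg a := a.2.1
  deg_smul g a := rfl

/-- The labels of a given degree. -/
noncomputable def RamificationLabel.fiberEquiv (G : Type u) [Group G]
    (r : ConjClasses G → Cardinal.{v}) (c : G) :
    (r (ConjClasses.mk c)).out ≃ {a : RamificationLabel G r // CrossedSet.deg a = c} :=
  Equiv.ofBijective (fun i => ⟨⟨ConjClasses.mk c, ⟨c, ConjClasses.mem_carrier_mk⟩, i⟩, rfl⟩) <| by
    constructor
    · intro i j h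
      exact (Prod.mk.inj (eq_of_heq (Sigma.mk.inj (Subtype.mk.inj h)).2)).2
    · rintro ⟨⟨C, ⟨d, hd⟩, i⟩, h⟩
      obtain rfl : d = c := h
      obtain rfl := ConjClasses.mem_carrier_iff_mk_eq.1 hd
      exact ⟨i, rfl⟩

/-- The labelling of the arrows of a quiver isomorphic to a Hopf quiver. -/
noncomputable def QuiverIso.arrowLabelling {V : Type u} [Quiver.{v} V] {G : Type u} [Group G]
    {r : ConjClasses G → Cardinal.{v}} (f : QuiverIso V (HopfQuiver G r)) :
    ArrowLabelling V G (RamificationLabel G r) where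
  vertex := f.vertexEquiv
  label y z := (f.arrowEquiv y z).trans (RamificationLabel.fiberEquiv G r _)

/-! ### The quiver of a graded Hopf algebra structure on a path coalgebra -/

namespace PathCoalgebra

variable {k : Type w} [Field k] {V : Type u} [Quiver.{v} V] {A : Type*} [Ring A] [HopfAlgebra k A]
  (e : PathCoalgebra k V ≃ₗc[k] A)

/-- The images of the paths as a basis. -/
noncomputable def imageBasis : Module.Basis (QuiverPath V) k A :=
  (basis k V).map (e : PathCoalgebra k V ≃ₗ[k] A)

theorem imageBasis_apply (p : QuiverPath V) : imageBasis e p = e (basis k V p) := rfl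

/-- The image of a vertex. -/
noncomputable def vertexImage (x : V) : A := imageBasis e ⟨x, x, .nil⟩

/-- The image of an arrow. -/
noncomputable def arrowImage {x y : V} (a : x ⟶ y) : A := imageBasis e ⟨x, y, a.toPath⟩

theorem vertexImage_injective : Function.Injective (vertexImage e) := fun x y h => by
  have := (imageBasis e).injective h
  cases this
  rfl

theorem comul_image (a : PathCoalgebra k V) : Coalgebra.comul (R := k) (e a) =
    TensorProduct.map (e : PathCoalgebra k V →ₗ[k] A) (e : PathCoalgebra k V →ₗ[k] A)
      (Coalgebra.comul (R := k) a) :=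
  (CoalgHomClass.map_comp_comul_apply e a).symm

theorem isGroupLikeElem_vertexImage (x : V) : IsGroupLikeElem k (vertexImage e x) := by
  refine IsGroupLikeElem.map e (a := basis k V ⟨x, x, .nil⟩) ⟨?_, ?_⟩
  · simp [counit_basis]
  · simp [comul_basis, pathSplits]

theorem comul_arrowImage {x y : V} (a : x ⟶ y) : Coalgebra.comul (R := k) (arrowImage e a) =
    vertexImage e y ⊗ₜ arrowImage e a + arrowImage e a ⊗ₜ vertexImage e x := by
  rw [arrowImage, imageBasis_apply, comul_image, comul_basis]
  simp [pathSplits, Quiver.Hom.toPath, vertexImage, imageBasis_apply]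

/-- The image of the span of the paths of length `n`. -/
noncomputable abbrev imagePart (n : ℕ) : Submodule k A :=
  (lengthPart k V n).map (e : PathCoalgebra k V →ₗ[k] A)

theorem imagePart_eq_span (n : ℕ) :
    imagePart e n = Submodule.span k (imageBasis e '' {p | p.2.2.length = n}) := by
  rw [imagePart, lengthPart, Submodule.map_span]
  congr 1
  ext z
  constructor
  · rintro ⟨_, ⟨p, hp, rfl⟩, rfl⟩
    exact ⟨p, hp, rfl⟩
  · rintro ⟨p, hp, rfl⟩
    exact ⟨_, ⟨p, hp, rfl⟩, rfl⟩

theorem imagePart_zero : imagePart e 0 = Submodule.span k (Set.range (vertexImage e)) := by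
  rw [imagePart_eq_span]
  congr 1
  ext z
  constructor
  · rintro ⟨⟨a, b, p⟩, hp, rfl⟩
    cases p with
    | nil => exact ⟨a, rfl⟩
    | cons p f => simp at hp
  · rintro ⟨x, rfl⟩
    exact ⟨⟨x, x, .nil⟩, rfl, rfl⟩

/-- Distinct group-like elements are linearly independent, so one that is not a vertex cannot lie in
the span of the vertices. -/
theorem exists_vertexImage_eq {g : A} (hg : IsGroupLikeElem k g) (h0 : g ∈ imagePart e 0) :
    ∃ x, vertexImage e x = g := by
  by_contra hne
  rw [imagePart_zero] at h0
  have hli := (linearIndepOn_isGroupLikeElem (R := k) (A := A)).mono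
    (Set.insert_subset hg (Set.range_subset_iff.2 (isGroupLikeElem_vertexImage e)))
  have := (linearIndepOn_id_insert (show g ∉ Set.range (vertexImage e) from hne)).1 hli
  exact this.2 h0

theorem vertexImage_mem (x : V) : vertexImage e x ∈ imagePart e 0 := by
  rw [imagePart_zero]
  exact Submodule.subset_span ⟨x, rfl⟩

theorem arrowImage_mem {x y : V} (a : x ⟶ y) : arrowImage e a ∈ imagePart e 1 :=
  ⟨_, Submodule.subset_span ⟨⟨x, y, a.toPath⟩, rfl, rfl⟩, rfl⟩

theorem imagePart_one : imagePart e 1 =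
    Submodule.span k {z | ∃ (x y : V) (a : x ⟶ y), arrowImage e a = z} := by
  rw [imagePart_eq_span]
  congr 1
  ext z
  constructor
  · rintro ⟨⟨a, b, p⟩, hp, rfl⟩
    match p, hp with
    | .cons .nil f, _ => exact ⟨_, _, f, rfl⟩
  · rintro ⟨x, y, a, rfl⟩
    exact ⟨⟨x, y, a.toPath⟩, rfl, rfl⟩

theorem coord_vertex_vertexImage_self (x : V) :
    (imageBasis e).coord ⟨x, x, .nil⟩ (vertexImage e x) = 1 := by
  simp [vertexImage]

theorem coord_vertex_vertexImage_of_ne {x y : V} (h : x ≠ y) :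
    (imageBasis e).coord ⟨x, x, .nil⟩ (vertexImage e y) = 0 := by
  simp only [vertexImage, Module.Basis.coord_apply, Module.Basis.repr_self]
  refine Finsupp.single_eq_of_ne fun h' => ?_
  cases h'
  exact h rfl

theorem coord_arrow_vertexImage (x : V) {y z : V} (a : y ⟶ z) :
    (imageBasis e).coord ⟨y, z, a.toPath⟩ (vertexImage e x) = 0 := by
  simp only [vertexImage, Module.Basis.coord_apply, Module.Basis.repr_self]
  refine Finsupp.single_eq_of_ne fun h => ?_
  cases h

/-- Pairing `Δ a` with the dual basis vectors of `q` and of one of its endpoints returns the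
coefficient of `q` in `a`. This detects the endpoints of the arrows that occur in a skew primitive
element. -/
theorem coord_eq_of_mem_imagePart_one {x y : V} (q : x ⟶ y) {a : A} (ha : a ∈ imagePart e 1) :
    LinearMap.mul' k k (TensorProduct.map ((imageBasis e).coord ⟨y, y, .nil⟩)
      ((imageBasis e).coord ⟨x, y, q.toPath⟩) (Coalgebra.comul (R := k) a)) =
        (imageBasis e).coord ⟨x, y, q.toPath⟩ a ∧
    LinearMap.mul' k k (TensorProduct.map ((imageBasis e).coord ⟨x, y, q.toPath⟩)
      ((imageBasis e).coord ⟨x, x, .nil⟩) (Coalgebra.comul (R := k) a)) =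
        (imageBasis e).coord ⟨x, y, q.toPath⟩ a := by
  rw [imagePart_one] at ha
  induction ha using Submodule.span_induction with
  | mem z hz =>
    obtain ⟨x', y', b, rfl⟩ := hz
    rw [comul_arrowImage]
    by_cases hb : (⟨x', y', b.toPath⟩ : QuiverPath V) = ⟨x, y, q.toPath⟩
    · cases hb
      simp [coord_vertex_vertexImage_self, coord_arrow_vertexImage,
        -Module.Basis.coord_apply]
    · have : (imageBasis e).coord ⟨x, y, q.toPath⟩ (arrowImage e b) = 0 := by
        simp only [arrowImage, Module.Basis.coord_apply, Module.Basis.repr_self]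
        exact Finsupp.single_eq_of_ne (Ne.symm hb)
      simp [coord_arrow_vertexImage, this, -Module.Basis.coord_apply]
  | zero => simp
  | add a b _ _ ha hb => simp only [map_add, ha.1, ha.2, hb.1, hb.2, and_self]
  | smul r a _ ha => simp only [map_smul, ha.1, ha.2, and_self]

/-- The images of the arrows from `x` to `y` span the skew primitive elements of degree one. -/
theorem mem_span_arrowImage_iff (x y : V) (a : A) :
    a ∈ Submodule.span k (Set.range (arrowImage e : (x ⟶ y) → A)) ↔
      a ∈ imagePart e 1 ∧ Coalgebra.comul (R := k) a =
        vertexImage e y ⊗ₜ a + a ⊗ₜ vertexImage e x := by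
  constructor
  · intro ha
    induction ha using Submodule.span_induction with
    | mem z hz =>
      obtain ⟨b, rfl⟩ := hz
      exact ⟨arrowImage_mem e b, comul_arrowImage e b⟩
    | zero => simp
    | add a b _ _ ha hb =>
      refine ⟨add_mem ha.1 hb.1, ?_⟩
      rw [map_add, ha.2, hb.2, TensorProduct.tmul_add, TensorProduct.add_tmul]
      abel
    | smul r a _ ha =>
      refine ⟨Submodule.smul_mem _ r ha.1, ?_⟩
      rw [map_smul, ha.2, TensorProduct.tmul_smul, ← TensorProduct.smul_tmul', smul_add]
  · rintro ⟨h1, h⟩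
    have hr : Set.range (arrowImage e : (x ⟶ y) → A) =
        imageBasis e '' Set.range fun a : x ⟶ y => ⟨x, y, a.toPath⟩ := by
      rw [← Set.range_comp]
      rfl
    have hs := h1
    rw [imagePart_eq_span, Module.Basis.mem_span_image] at hs
    rw [hr, Module.Basis.mem_span_image]
    rintro ⟨x', y', p⟩ hp
    have hp1 := hs hp
    match p, hp1 with
    | .cons .nil q, _ =>
      have h2 := coord_eq_of_mem_imagePart_one e q h1
      have hp2 : (imageBasis e).coord ⟨x', y', q.toPath⟩ a ≠ 0 := by simpa using! hp
      rw [h] at h2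
      -- The coordinate of `q` kills the vertex `y`, so on `y ⊗ a + a ⊗ x` the pairing gives the
      -- coefficient of `q` times the `x'`-coordinate of `x`, which is zero unless `x' = x`. The
      -- targets are compared likewise.
      have hx : x' = x := by
        by_contra hne
        refine hp2 (h2.2.symm.trans ?_)
        simp [coord_arrow_vertexImage, coord_vertex_vertexImage_of_ne e hne,
          -Module.Basis.coord_apply]
      have hy : y' = y := by
        by_contra hne
        refine hp2 (h2.1.symm.trans ?_)
        simp [coord_arrow_vertexImage, coord_vertex_vertexImage_of_ne e hne,
          -Module.Basis.coord_apply]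
      subst hx hy
      exact ⟨q, rfl⟩

theorem linearIndependent_arrowImage (x y : V) :
    LinearIndependent k (arrowImage e : (x ⟶ y) → A) := by
  refine (imageBasis e).linearIndependent.comp (fun a : x ⟶ y => ⟨x, y, a.toPath⟩) ?_
  intro a b h
  simpa [Quiver.Hom.toPath] using h

/-- The arrows are bases of the two spans, and bases of isomorphic vector spaces are equipotent,
also in infinite dimension. -/
theorem nonempty_arrow_equiv {x y x' y' : V} (f : A ≃ₗ[k] A)
    (h : (Submodule.span k (Set.range (arrowImage e : (x ⟶ y) → A))).map (f : A →ₗ[k] A) =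
      Submodule.span k (Set.range (arrowImage e : (x' ⟶ y') → A))) :
    Nonempty ((x ⟶ y) ≃ (x' ⟶ y')) :=
  ⟨((Module.Basis.span (linearIndependent_arrowImage e x y)).map
    (LinearEquiv.ofSubmodules f _ _ h)).indexEquiv
      (Module.Basis.span (linearIndependent_arrowImage e x' y'))⟩

/-! ### The group of vertices and its translations -/

/-- The vertices form a group under the multiplication of the Hopf algebra. -/
theorem exists_group (h : IsGradedHopfAlgebra k (imagePart e)) : ∃ _ : Group V,
    vertexImage e 1 = 1 ∧ ∀ x y, vertexImage e (x * y) = vertexImage e x * vertexImage e y := by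
  have hex : ∀ x y, ∃ z, vertexImage e z = vertexImage e x * vertexImage e y := fun x y =>
    exists_vertexImage_eq e
      ((isGroupLikeElem_vertexImage e x).mul (isGroupLikeElem_vertexImage e y))
      (by simpa only [add_zero] using h.mul_mem (vertexImage_mem e x) (vertexImage_mem e y))
  choose mul hmul using hex
  choose inv hinv using fun x => exists_vertexImage_eq e
    (isGroupLikeElem_vertexImage e x).antipode (h.antipode_mem (vertexImage_mem e x))
  obtain ⟨one, hone⟩ := exists_vertexImage_eq e IsGroupLikeElem.one h.one_mem
  let _ : Mul V := ⟨mul⟩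
  let _ : Inv V := ⟨inv⟩
  let _ : One V := ⟨one⟩
  have hm : ∀ x y : V, vertexImage e (x * y) = vertexImage e x * vertexImage e y := hmul
  have hi : ∀ x : V, vertexImage e x⁻¹ = HopfAlgebra.antipode k (vertexImage e x) := hinv
  have ho : vertexImage e (1 : V) = 1 := hone
  refine ⟨Group.ofLeftAxioms ?_ ?_ ?_, ho, hm⟩
  · intro x y z
    apply vertexImage_injective e
    simp only [hm, mul_assoc]
  · intro x
    apply vertexImage_injective e
    rw [hm, ho, one_mul]
  · intro x
    apply vertexImage_injective e
    rw [hm, ho, hi]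
    exact (isGroupLikeElem_vertexImage e x).antipode_mul_cancel

variable [Group V] (h1 : vertexImage e 1 = 1)
  (hm : ∀ x y, vertexImage e (x * y) = vertexImage e x * vertexImage e y)

/-- Multiplication by a vertex on the left and a vertex on the right. -/
noncomputable def vertexMulEquiv (g g' : V) : A ≃ₗ[k] A :=
  LinearEquiv.ofLinearMap
    (LinearMap.mulLeft k (vertexImage e g) ∘ₗ LinearMap.mulRight k (vertexImage e g'))
    (LinearMap.mulLeft k (vertexImage e g⁻¹) ∘ₗ LinearMap.mulRight k (vertexImage e g'⁻¹))
    (by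
      ext a
      simp only [LinearMap.comp_apply, LinearMap.mulLeft_apply, LinearMap.mulRight_apply,
        LinearMap.id_apply]
      rw [mul_assoc (vertexImage e g⁻¹), ← mul_assoc (vertexImage e g), ← mul_assoc, ← hm]
      simp [h1, ← hm, mul_assoc])
    (by
      ext a
      simp only [LinearMap.comp_apply, LinearMap.mulLeft_apply, LinearMap.mulRight_apply,
        LinearMap.id_apply]
      rw [mul_assoc (vertexImage e g), ← mul_assoc (vertexImage e g⁻¹), ← mul_assoc, ← hm]
      simp [h1, ← hm, mul_assoc])

include h1 hm in
-- Since `Δ` is multiplicative and vertices are group-like of degree zero, `a ↦ g * a * g'` takes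
-- the skew primitives for `x, y` to those for the translated vertices. Translation by `g⁻¹` and
-- `g'⁻¹` gives the reverse inclusion.
theorem nonempty_arrow_equiv_mul (h : IsGradedHopfAlgebra k (imagePart e)) (g g' x y : V) :
    Nonempty ((x ⟶ y) ≃ (g * x * g' ⟶ g * y * g')) := by
  have key : ∀ (g g' x y : V) (a : A),
      a ∈ Submodule.span k (Set.range (arrowImage e : (x ⟶ y) → A)) →
      vertexImage e g * (a * vertexImage e g') ∈
        Submodule.span k (Set.range (arrowImage e : (g * x * g' ⟶ g * y * g') → A)) := by
    intro g g' x y a ha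
    rw [mem_span_arrowImage_iff] at ha ⊢
    constructor
    · simpa using h.mul_mem (vertexImage_mem e g) (h.mul_mem ha.1 (vertexImage_mem e g'))
    · rw [Bialgebra.comul_mul, Bialgebra.comul_mul, ha.2,
        (isGroupLikeElem_vertexImage e g).comul_eq_tmul_self,
        (isGroupLikeElem_vertexImage e g').comul_eq_tmul_self]
      simp only [add_mul, mul_add, Algebra.TensorProduct.tmul_mul_tmul, hm, mul_assoc]
  refine nonempty_arrow_equiv e (vertexMulEquiv e h1 hm g g') (le_antisymm ?_ ?_)
  · rintro _ ⟨a, ha, rfl⟩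
    exact key g g' x y a ha
  · intro a ha
    refine ⟨(vertexMulEquiv e h1 hm g g').symm a, ?_, LinearEquiv.apply_symm_apply _ a⟩
    have := key g⁻¹ g'⁻¹ _ _ a ha
    have hc : ∀ z : V, g⁻¹ * (g * z * g') * g'⁻¹ = z := fun z => by group
    rwa [hc, hc] at this

include h1 hm in
/-- The quiver is the Hopf quiver of the group of vertices. -/
theorem nonempty_quiverIso (h : IsGradedHopfAlgebra k (imagePart e)) :
    ∃ r : ConjClasses V → Cardinal.{v}, Nonempty (QuiverIso V (HopfQuiver V r)) := by
  refine ⟨fun C => Cardinal.mk ((1 : V) ⟶ Quotient.out C), ?_⟩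
  have : ∀ x y : V, Nonempty ((x ⟶ y) ≃
      (Cardinal.mk ((1 : V) ⟶ Quotient.out (ConjClasses.mk (y * x⁻¹)))).out) := by
    intro x y
    have hc : IsConj (y * x⁻¹) (Quotient.out (ConjClasses.mk (y * x⁻¹))) :=
      ConjClasses.mk_eq_mk_iff_isConj.1 (Quotient.out_eq _).symm
    obtain ⟨g, hg⟩ := isConj_iff.1 hc
    -- The right factor is chosen so that `x` moves to `1`; then `y` moves to `g * (y * x⁻¹) * g⁻¹`,
    -- the chosen representative of the class.
    obtain ⟨f⟩ := nonempty_arrow_equiv_mul e h1 hm h g (x⁻¹ * g⁻¹) x y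
    have hx : g * x * (x⁻¹ * g⁻¹) = 1 := by group
    have hy : g * y * (x⁻¹ * g⁻¹) = g * (y * x⁻¹) * g⁻¹ := by group
    rw [hx, hy, hg] at f
    exact ⟨f.trans Cardinal.outMkEquiv.symm⟩
  exact ⟨⟨Equiv.refl V, fun x y => (this x y).some⟩⟩

end PathCoalgebra

/-! ### The two characterisations -/

theorem admitsGradedHopfStructure_iff (k : Type w) [Field k] (V : Type u) [Quiver.{v} V] :
    AdmitsGradedHopfStructure k V ↔
      ∃ (G : Type u) (_ : Group G) (r : ConjClasses G → Cardinal.{v}),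
        Nonempty (QuiverIso V (HopfQuiver G r)) := by
  constructor
  · rintro ⟨A, _, _, e, h⟩
    obtain ⟨_, h1, hm⟩ := PathCoalgebra.exists_group e h
    exact ⟨V, _, PathCoalgebra.nonempty_quiverIso e h1 hm h⟩
  · rintro ⟨G, _, r, ⟨f⟩⟩
    exact f.arrowLabelling.admitsGradedHopfStructure k

theorem finite_hom_hopfQuiver_iff {G : Type u} [Group G] {r : ConjClasses G → Cardinal.{v}}
    (x y : G) : Finite (Quiver.Hom (V := HopfQuiver G r) x y) ↔
      r (ConjClasses.mk (y * x⁻¹)) < Cardinal.aleph0 := by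
  rw [← Cardinal.mk_out (r (ConjClasses.mk (y * x⁻¹))), Cardinal.lt_aleph0_iff_finite]
  rfl

/-- Path coalgebras with a graded Hopf algebra structure are those of Hopf quivers. The first part
allows arbitrary, possibly infinite, multiplicities of arrows; the second part is the case of
multiplicities that are natural numbers. -/
theorem mainTheorem1 (k : Type w) [Field k] (V : Type u) [Quiver.{v} V] :
    (AdmitsGradedHopfStructure k V ↔
      ∃ (G : Type u) (_ : Group G) (r : ConjClasses G → Cardinal.{v}),
        Nonempty (QuiverIso V (HopfQuiver G r))) ∧
    ((AdmitsGradedHopfStructure k V ∧ ∀ x y : V, Finite (x ⟶ y)) ↔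
      ∃ (G : Type u) (_ : Group G) (r : ConjClasses G → ℕ),
        Nonempty (QuiverIso V (HopfQuiver G fun C => (r C : Cardinal.{v})))) := by
  refine ⟨admitsGradedHopfStructure_iff k V, ?_, ?_⟩
  · rintro ⟨h, hfin⟩
    obtain ⟨G, _, r, ⟨f⟩⟩ := (admitsGradedHopfStructure_iff k V).1 h
    have hr : ∀ C, ∃ n : ℕ, r C = n := by
      intro C
      obtain ⟨c, rfl⟩ := ConjClasses.exists_rep C
      -- The multiplicity of the class of `c` is the number of arrows from `1` to `c`, so every
      -- multiplicity is seen by some pair of vertices.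
      have : Finite (Quiver.Hom (V := HopfQuiver G r) (1 : G) c) := by
        obtain ⟨x, hx⟩ := f.vertexEquiv.surjective (1 : G)
        obtain ⟨y, hy⟩ := f.vertexEquiv.surjective c
        have := hfin x y
        rw [← hx, ← hy]
        exact Finite.of_equiv _ (f.arrowEquiv x y)
      have := (finite_hom_hopfQuiver_iff _ _).1 this
      rw [inv_one, mul_one] at this
      exact Cardinal.lt_aleph0.1 this
    choose n hn using hr
    obtain rfl : r = fun C => (n C : Cardinal.{v}) := funext hn
    exact ⟨G, _, n, ⟨f⟩⟩
  · rintro ⟨G, _, r, ⟨f⟩⟩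
    refine ⟨(admitsGradedHopfStructure_iff k V).2 ⟨G, _, _, ⟨f⟩⟩, fun x y => ?_⟩
    have : Finite (f.vertexEquiv x ⟶ f.vertexEquiv y) :=
      (finite_hom_hopfQuiver_iff (G := G) (r := fun C => (r C : Cardinal.{v})) _ _).2
        (Cardinal.natCast_lt_aleph0 ..)
    exact Finite.of_equiv _ (f.arrowEquiv x y).symm
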